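/- Let $\mathcal X$ be a Polish space with its Borel $\sigma$-field, let $\mathrm P(\mathcal X)$ be the set of Borel probability measures on $\mathcal X$, let $c:\mathcal X\times\mathcal X\to[0,\infty)$ be a lower semicontinuous cost function, and let $\mu\in\mathrm P(\mathcal X)$. For a bounded Borel function $f:\mathcal X\to\mathbb R$ put $Q_cf(x)=\inf_{y\in\mathcal X}\{f(y)+c(x,y)\}$. For $\nu_1,\nu_2\in\mathrm P(\mathcal X)$ let $$\mathcal T_c(\nu_1,\nu_2)=\inf\Big\{\int_{\mathcal X^2}c(x,y)\,d\pi(x,y)\;:\;\pi\in\mathrm P(\mathcal X^2)\text{ with first marginal }\nu_1\text{ and second marginal }\nu_2\Big\}\in[0,\infty]$$ and let $H(\nu|\mu)=\int\log\frac{d\nu}{d\mu}\,d\nu$ if $\nu\ll\mu$, and $H(\nu|\mu)=+\infty$ otherwise, be the relative entropy. Then the following are equivalent: 1. the couple $(\mu,c)$ satisfies Property $(\tau)$, i.e. for every bounded Borel function $f:\mathcal X\to\mathbb R$, $$\Big(\int e^{Q_cf}\,d\mu\Big)\Big(\int e^{-f}\,d\mu\Big)\le 1;$$ 2. for all $\nu_1,\nu_2\in\mathrm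 P(\mathcal X)$, $$\mathcal T_c(\nu_1,\nu_2)\le H(\nu_1|\mu)+H(\nu_2|\mu).$$ (The integrals in 1 are taken in $[0,\infty]$; the function $Q_cf$ is universally measurable.) -/

import Mathlib

open MeasureTheory
open scoped ENNReal NNReal

noncomputable section

namespace TransportEntropy

variable {X : Type*}

/-- The optimal transport cost `T_c(ν₁, ν₂)`: the infimum of `∫ c dπ` over all probability
measures `π` on `X × X` with first marginal `ν₁` and second marginal `ν₂`. -/
def transportCost [MeasurableSpace X] (c : X × X → ℝ≥0) (ν₁ ν₂ : Measure X) : ℝ≥0∞ :=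
  ⨅ (π : Measure (X × X)) (_ : IsProbabilityMeasure π) (_ : π.fst = ν₁) (_ : π.snd = ν₂),
    ∫⁻ p, (c p : ℝ≥0∞) ∂π

/-- `Q_c f (x) = inf_y {f y + c (x, y)}`. It is used for bounded `f` on a nonempty space, where the
infimum is over a nonempty set of reals that is bounded below. -/
def infConvolution (c : X × X → ℝ≥0) (f : X → ℝ) (x : X) : ℝ :=
  ⨅ y, (f y + (c (x, y) : ℝ))

/-- Property (τ) for the couple `(μ, c)`: `∫ e^{Q_c f} dμ · ∫ e^{-f} dμ ≤ 1` for all bounded Borel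
functions `f`. Both integrals are integrals of nonnegative functions, with values in `[0, ∞]`.
When `X` is Polish and `c` and `f` are Borel, each set `{Q_c f < t}` is the projection of a Borel
set, so that `Q_c f` is universally measurable and its exponential agrees `μ`-almost everywhere
with a Borel function; the first integral is the usual one (against the completion of `μ`). -/
def PropertyTau [MeasurableSpace X] (μ : Measure X) (c : X × X → ℝ≥0) : Prop :=
  ∀ f : X → ℝ, Measurable f → (∃ C : ℝ, ∀ x, |f x| ≤ C) →
    (∫⁻ x, ENNReal.ofReal (Real.exp (infConvolution c f x)) ∂μ) *
      (∫⁻ x, ENNReal.ofReal (Real.exp (-f x)) ∂μ) ≤ 1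

end TransportEntropy

end

namespace TransportEntropy

/-! Both conditions are dual to each other: entropy is dual to log-exponential integrals
(Donsker-Varadhan), transport cost to pairs `g x + f y ≤ c (x, y)` (Kantorovich).

From (τ) to transport: such a pair has `g ≤ Q_c (-f)`, so (τ) gives `∫ e^g dμ * ∫ e^f dμ ≤ 1`.
Applying Donsker-Varadhan to `g` and to `f` bounds the dual value by the sum of entropies, and
duality (`transportCost_le_of_dual_le`) bounds the cost. Conversely, the tilted measures `e^g μ` and
`e^{-f} μ`, normalised, attain equality in Donsker-Varadhan, so weak duality suffices.

Strong duality is a limit of finite problems. A binary coding embeds `X` measurably in Cantor space;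
fixing finitely many bits gives finite problems with costs below `c`, solved by Hahn-Banach. Their
potentials are bounded Borel functions on `X`. Compactness gives one coupling good for every finite
problem, and the costs increase to `c` by lower semicontinuity. -/

/-- Finite-dimensional Kantorovich duality. -/
theorem exists_coupling_of_dual_le {S T : Type*} [Fintype S] [Fintype T]
    (a : S → ℝ) (b : T → ℝ) (ha : ∑ s, a s = 1) (d : S → T → ℝ) (hd : ∀ s t, 0 ≤ d s t) (M : ℝ)
    (h : ∀ (g : S → ℝ) (f : T → ℝ), (∀ s t, g s + f t ≤ d s t) →
      ∑ s, a s * g s + ∑ t, b t * f t ≤ M) :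
    ∃ p ∈ stdSimplex ℝ (S × T), (∀ s, ∑ t, p (s, t) = a s) ∧ (∀ t, ∑ s, p (s, t) = b t) ∧
      ∑ q, p q * d q.1 q.2 ≤ M := by
  classical
  by_contra! hne
  let L : ((S × T) → ℝ) →ₗ[ℝ] (S → ℝ) × (T → ℝ) × ℝ :=
    { toFun := fun p => (fun s => ∑ t, p (s, t), fun t => ∑ s, p (s, t), ∑ q, p q * d q.1 q.2)
      map_add' := fun p q => by
        ext <;> simp [Finset.sum_add_distrib, add_mul]
      map_smul' := fun r p => by
        ext <;> simp [Finset.mul_sum, mul_assoc] }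
  have hLc : Continuous L := L.continuous_of_finiteDimensional
  obtain ⟨φ, u, v, hu, huv, hv⟩ := geometric_hahn_banach_compact_closed
    (s := L '' stdSimplex ℝ (S × T)) (t := {a} ×ˢ ({b} ×ˢ Set.Iic M))
    ((convex_stdSimplex ℝ (S × T)).linear_image L)
    ((isCompact_stdSimplex ℝ (S × T)).image hLc)
    ((convex_singleton a).prod ((convex_singleton b).prod (convex_Iic M)))
    (isClosed_singleton.prod (isClosed_singleton.prod isClosed_Iic))
    (by
      rw [Set.disjoint_left]
      rintro _ ⟨p, hp, rfl⟩ ⟨h1, h2, h3⟩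
      have := hne p hp (fun s => congrFun h1 s) (fun t => congrFun h2 t)
      exact absurd h3 (not_le.2 this))
  let g : S → ℝ := fun s => φ (Pi.single s 1, 0, 0)
  let f : T → ℝ := fun t => φ (0, Pi.single t 1, 0)
  let l : ℝ := φ (0, 0, 1)
  have hφ : ∀ (x : S → ℝ) (y : T → ℝ) (r : ℝ),
      φ (x, y, r) = ∑ s, x s * g s + ∑ t, y t * f t + r * l := by
    intro x y r
    have h1 : φ (x, 0, 0) = ∑ s, x s * g s := by
      have := LinearMap.pi_apply_eq_sum_univ
        (φ.toLinearMap ∘ₗ LinearMap.inl ℝ (S → ℝ) ((T → ℝ) × ℝ)) x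
      simp only [LinearMap.comp_apply, LinearMap.inl_apply, ContinuousLinearMap.coe_coe,
        smul_eq_mul] at this
      rw [show φ (x, 0, 0) = φ (x, (0 : (T → ℝ) × ℝ)) from rfl, this]
      refine Finset.sum_congr rfl fun s _ => ?_
      congr 2
      simp only [Prod.mk.injEq]
      refine ⟨?_, rfl⟩
      ext j; simp [Pi.single_apply, eq_comm]
    have h2 : φ (0, y, 0) = ∑ t, y t * f t := by
      have := LinearMap.pi_apply_eq_sum_univ
        (φ.toLinearMap ∘ₗ LinearMap.inr ℝ (S → ℝ) ((T → ℝ) × ℝ) ∘ₗ LinearMap.inl ℝ (T → ℝ) ℝ) y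
      simp only [LinearMap.comp_apply, LinearMap.inl_apply, LinearMap.inr_apply,
        ContinuousLinearMap.coe_coe, smul_eq_mul] at this
      rw [this]
      refine Finset.sum_congr rfl fun s _ => ?_
      congr 2
      simp only [Prod.mk.injEq, true_and]
      refine ⟨?_, trivial⟩
      ext j; simp [Pi.single_apply, eq_comm]
    have h3 : φ (0, 0, r) = r * l := by
      have := φ.map_smul r (0, 0, 1)
      simpa using this
    rw [← h1, ← h2, ← h3, ← map_add, ← map_add]
    simp
  have hcell : ∀ s t, g s + f t + d s t * l < u := by
    intro s t
    have := hu _ ⟨Pi.single (s, t) 1, single_mem_stdSimplex ℝ (s, t), rfl⟩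
    have e : L (Pi.single (s, t) 1) = (Pi.single s 1, Pi.single t 1, d s t) := by
      simp only [L, LinearMap.coe_mk, AddHom.coe_mk, Prod.mk.injEq]
      refine ⟨?_, ?_, ?_⟩
      · ext i; by_cases hi : i = s <;> simp [Pi.single_apply, hi]
      · ext i; by_cases hi : i = t <;> simp [Pi.single_apply, hi]
      · simp [Pi.single_apply]
    rw [e, hφ] at this
    simpa [Pi.single_apply] using this
  set A := ∑ s, a s * g s + ∑ t, b t * f t with hA
  have hval : ∀ r ≤ M, v < A + r * l := by
    intro r hr
    have := hv (a, b, r) ⟨rfl, rfl, hr⟩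
    rwa [hφ] at this
  -- The separation constant `u` is absorbed into the first potential, at cost exactly `k * u`
  -- because `a` has total mass 1.
  have hscale : ∀ k : ℝ, (∀ s t, k * (g s - u) + k * f t ≤ d s t) → k * (A - u) ≤ M := by
    intro k hk
    have := h (fun s => k * (g s - u)) (fun t => k * f t) hk
    refine le_of_eq_of_le ?_ this
    have e1 : ∑ s, a s * (k * (g s - u)) = k * ∑ s, a s * g s - k * u := by
      have : ∀ s, a s * (k * (g s - u)) = k * (a s * g s) - a s * (k * u) := fun s => by ring
      simp_rw [this, Finset.sum_sub_distrib, ← Finset.mul_sum, ← Finset.sum_mul, ha, one_mul]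
    have e2 : ∑ t, b t * (k * f t) = k * ∑ t, b t * f t := by
      rw [Finset.mul_sum]; exact Finset.sum_congr rfl fun t _ => by ring
    rw [e1, e2, hA]; ring
  have hl : l ≤ 0 := by
    by_contra! hpos
    -- If `l > 0`, a sufficiently negative `r` violates the separation.
    have h1 := hval (min M ((v - A) / l)) (min_le_left _ _)
    have h2 : min M ((v - A) / l) * l ≤ (v - A) / l * l :=
      mul_le_mul_of_nonneg_right (min_le_right _ _) hpos.le
    rw [div_mul_cancel₀ _ hpos.ne'] at h2
    linarith
  rcases hl.lt_or_eq with hneg | hzero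
  · have hk : 0 < (-l)⁻¹ := inv_pos.2 (by linarith)
    have hk1 : (-l)⁻¹ * (-l) = 1 := inv_mul_cancel₀ (by linarith)
    have := hscale (-l)⁻¹ fun s t => by
      have h1 := mul_le_mul_of_nonneg_left (hcell s t).le hk.le
      have h2 : (-l)⁻¹ * (g s + f t + d s t * l)
        = (-l)⁻¹ * (g s) + (-l)⁻¹ * f t - d s t * ((-l)⁻¹ * (-l)) := by ring
      rw [h2, hk1] at h1
      linarith
    have h1 := mul_lt_mul_of_pos_left (hval M le_rfl) hk
    have h2 : (-l)⁻¹ * (A + M * l) = (-l)⁻¹ * A - M * ((-l)⁻¹ * (-l)) := by ring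
    rw [h2, hk1] at h1
    have h3 := mul_lt_mul_of_pos_left huv hk
    linarith
  -- A separating functional blind to the cost stays dual feasible under every positive scaling, as
  -- `d ≥ 0`, so the dual value would be unbounded.
  · have hpos : 0 < A - u := by have := hval M le_rfl; rw [hzero] at this; linarith
    have := hscale ((|M| + 1) / (A - u)) fun s t => by
      have h1 := hcell s t
      rw [hzero] at h1
      rw [← mul_add]
      refine le_trans (mul_nonpos_of_nonneg_of_nonpos (by positivity) (by linarith)) (hd s t)
    rw [div_mul_cancel₀ _ hpos.ne'] at this
    linarith [le_abs_self M]

/-! ### Entropy, tilted measures and weak transport duality. -/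

section Entropy

variable {X : Type*} [MeasurableSpace X]

theorem integrable_of_abs_le {ν : Measure X} [IsFiniteMeasure ν] {g : X → ℝ} (hg : Measurable g)
    {C : ℝ} (hC : ∀ x, |g x| ≤ C) : Integrable g ν :=
  Integrable.of_bound hg.aestronglyMeasurable C (Filter.Eventually.of_forall hC)

theorem integrable_exp_of_abs_le {ν : Measure X} [IsFiniteMeasure ν] {g : X → ℝ}
    (hg : Measurable g) {C : ℝ} (hC : ∀ x, |g x| ≤ C) :
    Integrable (fun x => Real.exp (g x)) ν :=
  integrable_of_abs_le (Real.measurable_exp.comp hg) (C := Real.exp C) fun x => by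
    rw [abs_of_pos (Real.exp_pos _)]
    exact Real.exp_le_exp.2 ((le_abs_self _).trans (hC x))

/-- The Donsker-Varadhan inequality for bounded functions. -/
theorem integral_le_toReal_klDiv_add_log {ν μ : Measure X} [IsProbabilityMeasure ν]
    [IsProbabilityMeasure μ] (hkl : InformationTheory.klDiv ν μ ≠ ∞) {g : X → ℝ}
    (hg : Measurable g) {C : ℝ} (hC : ∀ x, |g x| ≤ C) :
    ∫ x, g x ∂ν ≤ (InformationTheory.klDiv ν μ).toReal
      + Real.log (∫ x, Real.exp (g x) ∂μ) := by
  obtain ⟨hac, hint⟩ := InformationTheory.klDiv_ne_top_iff.1 hkl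
  have hexp := integrable_exp_of_abs_le (ν := μ) hg hC
  have hgi := integrable_of_abs_le (ν := ν) hg hC
  have := isProbabilityMeasure_tilted hexp
  -- The inequality is nonnegativity of the entropy of `ν` relative to `μ.tilted g`.
  have h1 := integral_llr_tilted_right hac hgi hexp hint
  have h2 := InformationTheory.integral_llr_add_sub_measure_univ_nonneg
    (hac.trans (absolutelyContinuous_tilted hexp))
    (integrable_llr_tilted_right hac hgi hint hexp)
  rw [InformationTheory.toReal_klDiv_of_measure_eq hac (by simp)]
  simp only [probReal_univ] at h2
  linarith

/-- The equality case of Donsker-Varadhan: the log-density of the tilted measure is `g` minus a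
constant. -/
theorem klDiv_tilted_self {μ : Measure X} [IsProbabilityMeasure μ] {g : X → ℝ}
    (hg : Measurable g) {C : ℝ} (hC : ∀ x, |g x| ≤ C) :
    InformationTheory.klDiv (μ.tilted g) μ =
      ENNReal.ofReal (∫ x, g x ∂(μ.tilted g) - Real.log (∫ x, Real.exp (g x) ∂μ)) ∧
    0 ≤ ∫ x, g x ∂(μ.tilted g) - Real.log (∫ x, Real.exp (g x) ∂μ) := by
  have hexp := integrable_exp_of_abs_le (ν := μ) hg hC
  have := isProbabilityMeasure_tilted hexp
  have hac := tilted_absolutelyContinuous μ g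
  have hgi := integrable_of_abs_le (ν := μ.tilted g) hg hC
  have hllr : llr (μ.tilted g) μ =ᵐ[μ.tilted g]
      fun x => g x - Real.log (∫ x, Real.exp (g x) ∂μ) :=
    hac.ae_le (log_rnDeriv_tilted_left_self hexp)
  have hint : Integrable (llr (μ.tilted g) μ) (μ.tilted g) :=
    (hgi.sub (integrable_const _)).congr hllr.symm
  have hval : ∫ x, llr (μ.tilted g) μ x ∂(μ.tilted g)
      = ∫ x, g x ∂(μ.tilted g) - Real.log (∫ x, Real.exp (g x) ∂μ) := by
    rw [integral_congr_ae hllr, integral_sub hgi (integrable_const _)]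
    simp
  have h2 := InformationTheory.integral_llr_add_sub_measure_univ_nonneg hac hint
  rw [InformationTheory.klDiv_of_ac_of_integrable hac hint]
  simp only [probReal_univ, hval] at h2 ⊢
  constructor
  · congr 1; ring
  · linarith

theorem ofReal_integral_sub_le_transportCost {c : X × X → ℝ≥0} {ν₁ ν₂ : Measure X}
    [IsProbabilityMeasure ν₁] [IsProbabilityMeasure ν₂] {g f : X → ℝ}
    (hg : Measurable g) (hf : Measurable f) {C D : ℝ} (hC : ∀ x, |g x| ≤ C) (hD : ∀ x, |f x| ≤ D)
    (h : ∀ x y, g x ≤ f y + c (x, y)) :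
    ENNReal.ofReal (∫ x, g x ∂ν₁ - ∫ x, f x ∂ν₂) ≤ transportCost c ν₁ ν₂ := by
  refine le_iInf fun π => le_iInf fun hπ => le_iInf fun h1 => le_iInf fun h2 => ?_
  have e1 : ∫ x, g x ∂ν₁ = ∫ p, g p.1 ∂π := by
    rw [← h1, Measure.fst, integral_map measurable_fst.aemeasurable hg.aestronglyMeasurable]
  have e2 : ∫ x, f x ∂ν₂ = ∫ p, f p.2 ∂π := by
    rw [← h2, Measure.snd, integral_map measurable_snd.aemeasurable hf.aestronglyMeasurable]
  have i1 : Integrable (fun p : X × X => g p.1) π :=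
    integrable_of_abs_le (hg.comp measurable_fst) fun p => hC p.1
  have i2 : Integrable (fun p : X × X => f p.2) π :=
    integrable_of_abs_le (hf.comp measurable_snd) fun p => hD p.2
  rw [e1, e2, ← integral_sub i1 i2]
  -- Since `c ≥ 0`, even the positive part of `g x - f y` is at most `c`, and it can be integrated
  -- in `[0, ∞]`.
  refine (ENNReal.ofReal_le_ofReal (integral_mono (i1.sub i2) (i1.sub i2).pos_part
    fun p => le_max_left _ _)).trans ?_
  rw [ofReal_integral_eq_lintegral_ofReal (i1.sub i2).pos_part
    (Filter.Eventually.of_forall fun p => le_max_right _ _)]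
  refine lintegral_mono fun p => ?_
  rw [← ENNReal.ofReal_coe_nnreal]
  refine ENNReal.ofReal_le_ofReal (max_le ?_ (c p).2)
  have := h p.1 p.2
  simp only [Pi.sub_apply]
  linarith

omit [MeasurableSpace X] in
theorem bddBelow_infConvolution {c : X × X → ℝ≥0} {f : X → ℝ} {C : ℝ} (hC : ∀ x, |f x| ≤ C)
    (x : X) : BddBelow (Set.range fun y => f y + (c (x, y) : ℝ)) := by
  refine ⟨-C, ?_⟩
  rintro _ ⟨y, rfl⟩
  have := neg_le_of_abs_le (hC y)
  have := (c (x, y)).2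
  simp only; linarith

theorem propertyTau_of_transportCost_le {c : X × X → ℝ≥0} {μ : Measure X}
    [IsProbabilityMeasure μ]
    (h : ∀ ν₁ ν₂ : Measure X, IsProbabilityMeasure ν₁ → IsProbabilityMeasure ν₂ →
        transportCost c ν₁ ν₂ ≤ InformationTheory.klDiv ν₁ μ + InformationTheory.klDiv ν₂ μ) :
    PropertyTau μ c := by
  rintro f hf ⟨C, hC⟩
  have hne : Nonempty X := μ.nonempty_of_neZero
  -- `Q_c f` need not be Borel, so its exponential is approximated from below by simple functions.
  rw [lintegral_eq_nnreal, ENNReal.iSup_mul]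
  refine iSup_le fun φ => ?_
  rw [ENNReal.iSup_mul]
  refine iSup_le fun hφ => ?_
  -- The floor `e^{-C}` makes `log ψ` bounded and keeps `ψ ≤ e^{Q_c f}`, because `Q_c f ≥ -C`.
  let ψ : X → ℝ := fun x => max (φ x) (Real.exp (-C))
  have hψpos : ∀ x, 0 < ψ x := fun x => lt_max_of_lt_right (Real.exp_pos _)
  have hψm : Measurable ψ := (measurable_coe_nnreal_real.comp φ.measurable).max measurable_const
  let g : X → ℝ := fun x => Real.log (ψ x)
  have hgm : Measurable g := Real.measurable_log.comp hψm
  have hexpg : ∀ x, Real.exp (g x) = ψ x := fun x => Real.exp_log (hψpos x)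
  have hgQ : ∀ x y, g x ≤ f y + c (x, y) := by
    intro x y
    have hQ : infConvolution c f x ≤ f y + c (x, y) := ciInf_le (bddBelow_infConvolution hC x) y
    refine le_trans ?_ hQ
    rw [← Real.exp_le_exp, hexpg]
    refine max_le ?_ (Real.exp_le_exp.2 (le_ciInf fun z => ?_))
    · have := hφ x
      rwa [← ENNReal.ofReal_coe_nnreal, ENNReal.ofReal_le_ofReal_iff (Real.exp_pos _).le] at this
    · have h1 := neg_le_of_abs_le (hC z)
      have h2 := (c (x, z)).2
      linarith
  obtain ⟨D, hD⟩ : ∃ D, ∀ x, |g x| ≤ D := by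
    have hfin : (Set.range fun x => |g x|).Finite := by
      have : (Set.range fun x => |g x|) ⊆
          (fun r : ℝ≥0 => |Real.log (max (r : ℝ) (Real.exp (-C)))|) '' Set.range φ := by
        rintro _ ⟨x, rfl⟩
        exact ⟨φ x, ⟨x, rfl⟩, rfl⟩
      exact (φ.finite_range.image _).subset this
    obtain ⟨D, hD⟩ := hfin.bddAbove
    exact ⟨D, fun x => hD ⟨x, rfl⟩⟩
  have hnfm : Measurable fun x => -f x := hf.neg
  have hnC : ∀ x, |-f x| ≤ C := fun x => by rw [abs_neg]; exact hC x
  have ig := integrable_exp_of_abs_le (ν := μ) hgm hD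
  have inf := integrable_exp_of_abs_le (ν := μ) hnfm hnC
  have p1 := isProbabilityMeasure_tilted ig
  have p2 := isProbabilityMeasure_tilted inf
  obtain ⟨k1, n1⟩ := klDiv_tilted_self (μ := μ) hgm hD
  obtain ⟨k2, n2⟩ := klDiv_tilted_self (μ := μ) hnfm hnC
  have key := (ofReal_integral_sub_le_transportCost hgm hf hD hC hgQ).trans
    (h (μ.tilted g) (μ.tilted fun x => -f x) p1 p2)
  rw [k1, k2, ← ENNReal.ofReal_add n1 n2, ENNReal.ofReal_le_ofReal_iff (add_nonneg n1 n2),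
    integral_neg] at key
  have hpos1 := integral_exp_pos ig
  have hpos2 := integral_exp_pos inf
  have hlog : Real.log ((∫ x, Real.exp (g x) ∂μ) * ∫ x, Real.exp (-f x) ∂μ) ≤ 0 := by
    rw [Real.log_mul hpos1.ne' hpos2.ne']
    linarith
  have hprod : (∫ x, Real.exp (g x) ∂μ) * ∫ x, Real.exp (-f x) ∂μ ≤ 1 :=
    (Real.log_nonpos_iff (mul_pos hpos1 hpos2).le).1 hlog
  calc (φ.map ((↑) : ℝ≥0 → ℝ≥0∞)).lintegral μ * ∫⁻ x, ENNReal.ofReal (Real.exp (-f x)) ∂μ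
      ≤ (∫⁻ x, ENNReal.ofReal (Real.exp (g x)) ∂μ)
        * ∫⁻ x, ENNReal.ofReal (Real.exp (-f x)) ∂μ := by
        gcongr
        rw [← SimpleFunc.lintegral_eq_lintegral]
        refine lintegral_mono fun x => ?_
        rw [hexpg, SimpleFunc.map_apply, ← ENNReal.ofReal_coe_nnreal]
        exact ENNReal.ofReal_le_ofReal (le_max_left _ _)
    _ = ENNReal.ofReal ((∫ x, Real.exp (g x) ∂μ) * ∫ x, Real.exp (-f x) ∂μ) := by
        rw [ENNReal.ofReal_mul hpos1.le,
          ofReal_integral_eq_lintegral_ofReal ig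
            (Filter.Eventually.of_forall fun x => (Real.exp_pos _).le),
          ofReal_integral_eq_lintegral_ofReal inf
            (Filter.Eventually.of_forall fun x => (Real.exp_pos _).le)]
    _ ≤ 1 := ENNReal.ofReal_le_one.2 hprod

/-- Property (τ) bounds the dual functional of the transport problem by the entropies. -/
theorem PropertyTau.integral_add_integral_le {c : X × X → ℝ≥0} {μ : Measure X}
    [IsProbabilityMeasure μ] (hτ : PropertyTau μ c) {ν₁ ν₂ : Measure X} [IsProbabilityMeasure ν₁]
    [IsProbabilityMeasure ν₂] (h₁ : InformationTheory.klDiv ν₁ μ ≠ ∞)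
    (h₂ : InformationTheory.klDiv ν₂ μ ≠ ∞) {g f : X → ℝ} (hg : Measurable g) (hf : Measurable f)
    {C D : ℝ} (hC : ∀ x, |g x| ≤ C) (hD : ∀ x, |f x| ≤ D) (h : ∀ x y, g x + f y ≤ c (x, y)) :
    ∫ x, g x ∂ν₁ + ∫ x, f x ∂ν₂ ≤
      (InformationTheory.klDiv ν₁ μ + InformationTheory.klDiv ν₂ μ).toReal := by
  have hne : Nonempty X := μ.nonempty_of_neZero
  have ig := integrable_exp_of_abs_le (ν := μ) hg hC
  have inf := integrable_exp_of_abs_le (ν := μ) hf hD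
  have hpos1 := integral_exp_pos ig
  have hpos2 := integral_exp_pos inf
  have hτf := hτ (fun x => -f x) hf.neg ⟨D, fun x => by rw [abs_neg]; exact hD x⟩
  simp only [neg_neg] at hτf
  have hprod : ENNReal.ofReal ((∫ x, Real.exp (g x) ∂μ) * ∫ x, Real.exp (f x) ∂μ) ≤ 1 := by
    rw [ENNReal.ofReal_mul hpos1.le,
      ofReal_integral_eq_lintegral_ofReal ig
        (Filter.Eventually.of_forall fun x => (Real.exp_pos _).le),
      ofReal_integral_eq_lintegral_ofReal inf
        (Filter.Eventually.of_forall fun x => (Real.exp_pos _).le)]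
    refine le_trans ?_ hτf
    gcongr with x
    -- Feasibility of the pair says exactly that `g ≤ Q_c (-f)`.
    refine le_ciInf fun y => ?_
    linarith [h x y]
  have hlog := Real.log_nonpos (mul_pos hpos1 hpos2).le (ENNReal.ofReal_le_one.1 hprod)
  rw [Real.log_mul hpos1.ne' hpos2.ne'] at hlog
  rw [ENNReal.toReal_add h₁ h₂]
  linarith [integral_le_toReal_klDiv_add_log h₁ hg hC, integral_le_toReal_klDiv_add_log h₂ hf hD]

end Entropy

/-! ### Compactness of couplings on Cantor space. -/

section Cantor

/-- The section `σ` of `r` lifts a discrete coupling to `Ω × Ω`; only its marginals seen through `r`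
are controlled. -/
theorem map_fst_sum_smul_dirac {Ω F : Type*} [MeasurableSpace Ω] [Fintype F] [MeasurableSpace F]
    [MeasurableSingletonClass F] {p : F × F → ℝ} (hp : ∀ q, 0 ≤ p q) {σ : F → Ω} {r : Ω → F}
    (hr : Measurable r) (hσ : ∀ s, r (σ s) = s) {ν : Measure F} [IsFiniteMeasure ν]
    (hν : ∀ s, ∑ t, p (s, t) = ν.real {s}) :
    (∑ q, ENNReal.ofReal (p q) • Measure.dirac (σ q.1, σ q.2)).map (fun ω => r ω.1) = ν := by
  classical
  refine Measure.ext_of_singleton fun s => ?_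
  have hrn : Measurable fun ω : Ω × Ω => r ω.1 := hr.comp measurable_fst
  have hm : MeasurableSet ((fun ω : Ω × Ω => r ω.1) ⁻¹' {s}) := hrn (measurableSet_singleton s)
  rw [Measure.map_apply hrn (measurableSet_singleton s)]
  have : ∀ a b : F, (Measure.dirac (σ a, σ b)) ((fun ω : Ω × Ω => r ω.1) ⁻¹' {s})
      = if a = s then (1 : ℝ≥0∞) else 0 := by
    intro a b
    rw [Measure.dirac_apply' _ hm]
    simp [Set.indicator_apply, hσ]
  simp only [Measure.finsetSum_apply, Measure.smul_apply, this, smul_eq_mul, mul_ite,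
    mul_one, mul_zero, Fintype.sum_prod_type]
  rw [Finset.sum_eq_single s (fun b _ hb => by simp [hb]) (by simp)]
  simp only [if_true]
  rw [← ENNReal.ofReal_sum_of_nonneg fun q _ => hp _, hν, ofReal_measureReal]

theorem map_snd_sum_smul_dirac {Ω F : Type*} [MeasurableSpace Ω] [Fintype F] [MeasurableSpace F]
    [MeasurableSingletonClass F] {p : F × F → ℝ} (hp : ∀ q, 0 ≤ p q) {σ : F → Ω} {r : Ω → F}
    (hr : Measurable r) (hσ : ∀ s, r (σ s) = s) {ν : Measure F} [IsFiniteMeasure ν]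
    (hν : ∀ s, ∑ t, p (t, s) = ν.real {s}) :
    (∑ q, ENNReal.ofReal (p q) • Measure.dirac (σ q.1, σ q.2)).map (fun ω => r ω.2) = ν := by
  classical
  refine Measure.ext_of_singleton fun s => ?_
  have hrn : Measurable fun ω : Ω × Ω => r ω.2 := hr.comp measurable_snd
  have hm : MeasurableSet ((fun ω : Ω × Ω => r ω.2) ⁻¹' {s}) := hrn (measurableSet_singleton s)
  rw [Measure.map_apply hrn (measurableSet_singleton s)]
  have : ∀ a b : F, (Measure.dirac (σ a, σ b)) ((fun ω : Ω × Ω => r ω.2) ⁻¹' {s})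
      = if b = s then (1 : ℝ≥0∞) else 0 := by
    intro a b
    rw [Measure.dirac_apply' _ hm]
    simp [Set.indicator_apply, hσ]
  simp only [Measure.finsetSum_apply, Measure.smul_apply, this, smul_eq_mul, mul_ite,
    mul_one, mul_zero, Fintype.sum_prod_type_right]
  rw [Finset.sum_eq_single s (fun b _ hb => by simp [hb]) (by simp)]
  simp only [if_true]
  rw [← ENNReal.ofReal_sum_of_nonneg fun q _ => hp _, hν, ofReal_measureReal]

/-- A projective family of finite transport problems whose dual values are bounded by `M` has a
common coupling of cost at most `M`. -/
theorem exists_coupling_cantor (ρ₁ ρ₂ : ProbabilityMeasure (ℕ → Bool))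
    (d : ∀ I : Finset ℕ, (I → Bool) → (I → Bool) → ℝ≥0)
    (hmono : ∀ I J : Finset ℕ, I ⊆ J → ∀ k l : ℕ → Bool,
      d I (I.restrict k) (I.restrict l) ≤ d J (J.restrict k) (J.restrict l)) (M : ℝ≥0)
    (h : ∀ (I : Finset ℕ) (g f : (I → Bool) → ℝ), (∀ s t, g s + f t ≤ d I s t) →
      ∑ s, ((ρ₁ : Measure (ℕ → Bool)).map I.restrict).real {s} * g s
        + ∑ t, ((ρ₂ : Measure (ℕ → Bool)).map I.restrict).real {t} * f t ≤ M) :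
    ∃ π : Measure ((ℕ → Bool) × (ℕ → Bool)), IsProbabilityMeasure π ∧
      π.fst = ρ₁ ∧ π.snd = ρ₂ ∧
      ∀ I : Finset ℕ, ∫⁻ p, d I (I.restrict p.1) (I.restrict p.2) ∂π ≤ M := by
  have hrc : ∀ I : Finset ℕ, Continuous (I.restrict (π := fun _ => Bool)) :=
    fun I => I.continuous_restrict
  have hrm : ∀ I : Finset ℕ, Measurable (I.restrict (π := fun _ => Bool)) :=
    fun I => I.measurable_restrict
  have h1c : ∀ I : Finset ℕ, Continuous
      fun p : (ℕ → Bool) × (ℕ → Bool) => I.restrict (π := fun _ => Bool) p.1 :=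
    fun I => (hrc I).comp continuous_fst
  have h2c : ∀ I : Finset ℕ, Continuous
      fun p : (ℕ → Bool) × (ℕ → Bool) => I.restrict (π := fun _ => Bool) p.2 :=
    fun I => (hrc I).comp continuous_snd
  have hdc : ∀ I : Finset ℕ, Continuous fun p : (ℕ → Bool) × (ℕ → Bool) =>
      d I (I.restrict p.1) (I.restrict p.2) := fun I =>
    (continuous_of_discreteTopology (f := fun q : (I → Bool) × (I → Bool) => d I q.1 q.2)).comp
      ((h1c I).prodMk (h2c I))
  let C : Finset ℕ → Set (ProbabilityMeasure ((ℕ → Bool) × (ℕ → Bool))) := fun I =>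
    {π | π.map (h1c I).measurable.aemeasurable = ρ₁.map (hrm I).aemeasurable} ∩
    ({π | π.map (h2c I).measurable.aemeasurable = ρ₂.map (hrm I).aemeasurable} ∩
    {π | ∫⁻ p, d I (I.restrict p.1) (I.restrict p.2) ∂(π : Measure ((ℕ → Bool) × (ℕ → Bool))) ≤ M})
  have hclosed : ∀ I, IsClosed (C I) := by
    intro I
    refine (isClosed_eq (ProbabilityMeasure.continuous_map (h1c I)) continuous_const).inter
      ((isClosed_eq (ProbabilityMeasure.continuous_map (h2c I)) continuous_const).inter
      (isClosed_le ?_ continuous_const))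
    rw [continuous_iff_continuousAt]
    intro π
    -- The cost depends on finitely many bits, hence is continuous and bounded, so its integral is
    -- weakly continuous.
    exact ProbabilityMeasure.tendsto_iff_forall_lintegral_tendsto.1 Filter.tendsto_id
      (BoundedContinuousFunction.mkOfCompact ⟨_, hdc I⟩)
  have hsub : ∀ I J : Finset ℕ, I ⊆ J → C J ⊆ C I := by
    rintro I J hIJ π ⟨e1, e2, e3⟩
    have hm2 : Measurable (Finset.restrict₂ (π := fun _ => Bool) hIJ) :=
      Finset.measurable_restrict₂ hIJ
    refine ⟨?_, ?_, ?_⟩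
    · apply Subtype.ext
      have := congrArg (fun ρ => Measure.map (Finset.restrict₂ (π := fun _ => Bool) hIJ) ρ)
        (congrArg Subtype.val e1)
      simp only [ProbabilityMeasure.val_eq_to_measure, ProbabilityMeasure.toMeasure_map] at this ⊢
      rwa [Measure.map_map hm2 (h1c J).measurable, Measure.map_map hm2 (hrm J)] at this
    · apply Subtype.ext
      have := congrArg (fun ρ => Measure.map (Finset.restrict₂ (π := fun _ => Bool) hIJ) ρ)
        (congrArg Subtype.val e2)
      simp only [ProbabilityMeasure.val_eq_to_measure, ProbabilityMeasure.toMeasure_map] at this ⊢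
      rwa [Measure.map_map hm2 (h2c J).measurable, Measure.map_map hm2 (hrm J)] at this
    · refine le_trans (lintegral_mono fun p => ?_) e3
      exact ENNReal.coe_le_coe.2 (hmono I J hIJ p.1 p.2)
  have hne : ∀ I, (C I).Nonempty := by
    intro I
    have hp1 : IsProbabilityMeasure ((ρ₁ : Measure (ℕ → Bool)).map I.restrict) :=
      Measure.isProbabilityMeasure_map (hrm I).aemeasurable
    have hp2 : IsProbabilityMeasure ((ρ₂ : Measure (ℕ → Bool)).map I.restrict) :=
      Measure.isProbabilityMeasure_map (hrm I).aemeasurable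
    obtain ⟨p, ⟨hp0, hp1'⟩, ha, hb, hcost⟩ := exists_coupling_of_dual_le
      (fun s => ((ρ₁ : Measure (ℕ → Bool)).map I.restrict).real {s})
      (fun s => ((ρ₂ : Measure (ℕ → Bool)).map I.restrict).real {s})
      (by simp) (fun s t => (d I s t : ℝ)) (fun s t => (d I s t).2) M (h I)
    obtain ⟨σ, hσ⟩ : ∃ σ : (I → Bool) → (ℕ → Bool), ∀ s, I.restrict (σ s) = s :=
      ⟨fun s n => if hn : n ∈ I then s ⟨n, hn⟩ else false, fun s => by
        ext n; simp [Finset.restrict]⟩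
    let π : Measure ((ℕ → Bool) × (ℕ → Bool)) :=
      ∑ q, ENNReal.ofReal (p q) • Measure.dirac (σ q.1, σ q.2)
    have hπ : IsProbabilityMeasure π := by
      refine ⟨?_⟩
      simp only [π, Measure.finsetSum_apply, Measure.smul_apply, measure_univ, smul_eq_mul,
        mul_one]
      rw [← ENNReal.ofReal_sum_of_nonneg fun q _ => hp0 q, hp1', ENNReal.ofReal_one]
    refine ⟨⟨π, hπ⟩, ?_, ?_, ?_⟩
    · apply Subtype.ext
      change π.map (fun p => I.restrict (π := fun _ => Bool) p.1) =
        (ρ₁ : Measure (ℕ → Bool)).map I.restrict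
      exact map_fst_sum_smul_dirac hp0 (hrm I) hσ ha
    · apply Subtype.ext
      change π.map (fun p => I.restrict (π := fun _ => Bool) p.2) =
        (ρ₂ : Measure (ℕ → Bool)).map I.restrict
      exact map_snd_sum_smul_dirac hp0 (hrm I) hσ hb
    · change ∫⁻ p, d I (I.restrict p.1) (I.restrict p.2) ∂π ≤ M
      simp only [π, lintegral_finsetSum_measure, lintegral_smul_measure]
      have : ∀ q : (I → Bool) × (I → Bool), ∫⁻ p : (ℕ → Bool) × (ℕ → Bool),
          (d I (I.restrict p.1) (I.restrict p.2) : ℝ≥0∞) ∂(Measure.dirac (σ q.1, σ q.2))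
            = d I q.1 q.2 := by
        intro q
        rw [lintegral_dirac' _ (hdc I).measurable.coe_nnreal_ennreal]
        simp only [hσ]
      simp only [this, smul_eq_mul]
      have e : ∀ q : (I → Bool) × (I → Bool), ENNReal.ofReal (p q) * (d I q.1 q.2 : ℝ≥0∞)
          = ENNReal.ofReal (p q * d I q.1 q.2) := fun q => by
        rw [ENNReal.ofReal_mul (hp0 q), ENNReal.ofReal_coe_nnreal]
      simp only [e]
      rw [← ENNReal.ofReal_sum_of_nonneg fun q _ => mul_nonneg (hp0 q) (d I q.1 q.2).coe_nonneg,
        ← ENNReal.ofReal_coe_nnreal]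
      exact ENNReal.ofReal_le_ofReal hcost
  -- Probability measures on a compact metrizable space form a compact space, and the sets `C I` are
  -- directed downwards.
  obtain ⟨π, hπ⟩ := IsCompact.nonempty_iInter_of_directed_nonempty_isCompact_isClosed C
    (fun I J => ⟨I ∪ J, hsub _ _ Finset.subset_union_left, hsub _ _ Finset.subset_union_right⟩)
    hne (fun I => (hclosed I).isCompact) hclosed
  rw [Set.mem_iInter] at hπ
  have hproj : ∀ ρ : ProbabilityMeasure (ℕ → Bool), IsProjectiveLimit (ρ : Measure (ℕ → Bool))
      (fun I : Finset ℕ => (ρ : Measure (ℕ → Bool)).map I.restrict) := fun ρ I => rfl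
  have hfin : ∀ ρ : ProbabilityMeasure (ℕ → Bool), ∀ I : Finset ℕ,
      IsFiniteMeasure ((ρ : Measure (ℕ → Bool)).map I.restrict) := fun ρ I => inferInstance
  refine ⟨π, inferInstance, ?_, ?_, fun I => (hπ I).2.2⟩
  · have := hfin ρ₁
    refine IsProjectiveLimit.unique (fun I => ?_) (hproj ρ₁)
    have := congrArg Subtype.val (hπ I).1
    simp only [ProbabilityMeasure.val_eq_to_measure, ProbabilityMeasure.toMeasure_map] at this
    rw [← this, Measure.fst, Measure.map_map (hrm I) measurable_fst]
    rfl
  · have := hfin ρ₂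
    refine IsProjectiveLimit.unique (fun I => ?_) (hproj ρ₂)
    have := congrArg Subtype.val (hπ I).2.1
    simp only [ProbabilityMeasure.val_eq_to_measure, ProbabilityMeasure.toMeasure_map] at this
    rw [← this, Measure.snd, Measure.map_map (hrm I) measurable_snd]
    rfl

end Cantor

/-! ### Binary coding of a Polish space and passage to the limit. -/

section Coding

variable {X : Type*}

/-- The bits are the indicators of a countable basis. The coding need not be continuous; the last
clause says that its inverse is, which is what the semicontinuity argument uses. -/
theorem exists_binary_coding [TopologicalSpace X] [SecondCountableTopology X] [T1Space X]
    [MeasurableSpace X] [OpensMeasurableSpace X] [Nonempty X] :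
    ∃ e : X → ℕ → Bool, Measurable e ∧ Function.Injective e ∧
      ∀ x, ∀ U ∈ nhds x, ∃ n, ∀ x', e x' n = e x n → x' ∈ U := by
  classical
  obtain ⟨b, hbc, -, hb⟩ := TopologicalSpace.exists_countable_basis X
  have hbne : b.Nonempty := by
    obtain ⟨x⟩ := ‹Nonempty X›
    obtain ⟨v, hv, -⟩ := hb.exists_subset_of_mem_open (Set.mem_univ x) isOpen_univ
    exact ⟨v, hv⟩
  obtain ⟨V, rfl⟩ := hbc.exists_eq_range hbne
  have hsep : ∀ x, ∀ U ∈ nhds x, ∃ n, ∀ x',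
      decide (x' ∈ V n) = decide (x ∈ V n) → x' ∈ U := by
    intro x U hU
    obtain ⟨_, ⟨n, rfl⟩, hx, hsub⟩ := hb.mem_nhds_iff.1 hU
    exact ⟨n, fun x' hx' => hsub ((decide_eq_decide.1 hx').2 hx)⟩
  refine ⟨fun x n => decide (x ∈ V n), measurable_pi_lambda _ fun n => ?_, fun x y hxy => ?_, hsep⟩
  · exact measurable_to_bool (by
      simpa [Set.preimage] using (hb.isOpen ⟨n, rfl⟩).measurableSet)
  · by_contra hne
    obtain ⟨n, hn⟩ := hsep x {y}ᶜ (isOpen_compl_singleton.mem_nhds hne)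
    exact hn y (congrFun hxy n).symm rfl

/-- The largest cost on the cells of the partition by the first coordinates in `I` of the coding
`e` that lies below `c`, truncated at the cardinality of `I`. -/
noncomputable def cellCost (c : X × X → ℝ≥0) (e : X → ℕ → Bool) (I : Finset ℕ) (s t : I → Bool) : ℝ≥0 :=
  (min (I.card : ℝ≥0∞) (⨅ (x) (y) (_ : I.restrict (e x) = s) (_ : I.restrict (e y) = t),
    (c (x, y) : ℝ≥0∞))).toNNReal

/-- The truncation keeps the value finite even on empty cells, where the infimum is `∞`. -/
theorem coe_cellCost (c : X × X → ℝ≥0) (e : X → ℕ → Bool) (I : Finset ℕ) (s t : I → Bool) :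
    (cellCost c e I s t : ℝ≥0∞) = min (I.card : ℝ≥0∞)
      (⨅ (x) (y) (_ : I.restrict (e x) = s) (_ : I.restrict (e y) = t), (c (x, y) : ℝ≥0∞)) :=
  ENNReal.coe_toNNReal (ne_top_of_le_ne_top (ENNReal.natCast_ne_top _) (min_le_left _ _))

theorem cellCost_le (c : X × X → ℝ≥0) (e : X → ℕ → Bool) (I : Finset ℕ) (x y : X) :
    cellCost c e I (I.restrict (e x)) (I.restrict (e y)) ≤ c (x, y) := by
  rw [← ENNReal.coe_le_coe, coe_cellCost]
  exact (min_le_right _ _).trans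
    (iInf_le_of_le x (iInf_le_of_le y (iInf_le_of_le rfl (iInf_le_of_le rfl le_rfl))))

theorem cellCost_mono (c : X × X → ℝ≥0) (e : X → ℕ → Bool) {I J : Finset ℕ} (hIJ : I ⊆ J)
    (k l : ℕ → Bool) : cellCost c e I (I.restrict k) (I.restrict l) ≤
      cellCost c e J (J.restrict k) (J.restrict l) := by
  rw [← ENNReal.coe_le_coe, coe_cellCost, coe_cellCost]
  refine min_le_min (by exact_mod_cast Finset.card_le_card hIJ) ?_
  refine le_iInf fun x => le_iInf fun y => le_iInf fun hx => le_iInf fun hy => ?_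
  exact iInf_le_of_le x (iInf_le_of_le y (iInf_le_of_le
    (congrArg (Finset.restrict₂ (π := fun _ => Bool) hIJ) hx)
    (iInf_le_of_le (congrArg (Finset.restrict₂ (π := fun _ => Bool) hIJ) hy) le_rfl)))

theorem le_iSup_cellCost [TopologicalSpace X] {c : X × X → ℝ≥0} (hc : LowerSemicontinuous c)
    {e : X → ℕ → Bool} (he : ∀ x, ∀ U ∈ nhds x, ∃ n, ∀ x', e x' n = e x n → x' ∈ U) (x y : X) :
    (c (x, y) : ℝ≥0∞) ≤ ⨆ n : ℕ, (cellCost c e (Finset.range n)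
      ((Finset.range n).restrict (e x)) ((Finset.range n).restrict (e y)) : ℝ≥0∞) := by
  refine le_of_forall_lt fun t ht => ?_
  obtain ⟨u, htu, hu⟩ := exists_between ht
  refine htu.trans_le ?_
  lift u to ℝ≥0 using hu.ne_top
  have hnhds := hc (x, y) u (ENNReal.coe_lt_coe.1 hu)
  rw [nhds_prod_eq] at hnhds
  obtain ⟨U, hU, V, hV, hUV⟩ := Filter.mem_prod_iff.1 hnhds
  obtain ⟨i, hi⟩ := he x U hU
  obtain ⟨j, hj⟩ := he y V hV
  obtain ⟨k, hk⟩ := exists_nat_ge u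
  -- Bits `i` and `j` confine the cells to `U` and `V`, where `c > u`; `k ≥ u` keeps the truncation
  -- from interfering.
  let n := max (max (i + 1) (j + 1)) k
  have hin : i ∈ Finset.range n := by simp [n]
  have hjn : j ∈ Finset.range n := by simp [n]
  have hkn : k ≤ n := le_max_right _ _
  refine le_iSup_of_le n ?_
  rw [coe_cellCost, Finset.card_range]
  refine le_min ?_ (le_iInf fun x' => le_iInf fun y' => le_iInf fun hx => le_iInf fun hy => ?_)
  · refine le_trans (ENNReal.coe_le_coe.2 hk) ?_
    simpa using hkn
  · have h1 : x' ∈ U := hi x' (congrFun hx ⟨i, hin⟩)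
    have h2 : y' ∈ V := hj y' (congrFun hy ⟨j, hjn⟩)
    have h3 : (x', y') ∈ {p | u < c p} := hUV ⟨h1, h2⟩
    exact ENNReal.coe_le_coe.2 (le_of_lt h3)

/-- Both marginals live on the range of `e`, so `π` lives on the square of that range and can be
pulled back without losing mass. -/
theorem exists_comap_coupling {Y : Type*} [MeasurableSpace X] [MeasurableSpace Y] {e : X → Y}
    (he : MeasurableEmbedding e) {ν₁ ν₂ : Measure X} {π : Measure (Y × Y)}
    (h₁ : π.fst = ν₁.map e) (h₂ : π.snd = ν₂.map e) :
    ∃ π' : Measure (X × X), π'.fst = ν₁ ∧ π'.snd = ν₂ ∧ π'.map (Prod.map e e) = π := by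
  have hφ : MeasurableEmbedding (Prod.map e e) := he.prodMap he
  have hr : MeasurableSet (Set.range e)ᶜ := he.measurableSet_range.compl
  have hz : ∀ ν : Measure X, ν.map e (Set.range e)ᶜ = 0 := by
    intro ν
    rw [he.map_apply]
    simp [Set.preimage_compl]
  have hnull : π (Set.range (Prod.map e e))ᶜ = 0 := by
    refine measure_mono_null (t := Prod.fst ⁻¹' (Set.range e)ᶜ ∪ Prod.snd ⁻¹' (Set.range e)ᶜ) ?_
      (measure_union_null ?_ ?_)
    · rw [Set.range_prodMap]
      intro p hp
      by_contra hcon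
      simp only [Set.mem_union, Set.mem_preimage, Set.mem_compl_iff, not_or, not_not] at hcon
      exact hp ⟨hcon.1, hcon.2⟩
    · rw [← Measure.fst_apply hr, h₁, hz]
    · rw [← Measure.snd_apply hr, h₂, hz]
  have hmap : (π.comap (Prod.map e e)).map (Prod.map e e) = π := by
    rw [hφ.map_comap, Measure.restrict_eq_self_of_ae_mem]
    exact hnull
  refine ⟨π.comap (Prod.map e e), ?_, ?_, hmap⟩
  · rw [← he.comap_map (π.comap (Prod.map e e)).fst, ← he.comap_map ν₁, ← h₁]
    congr 1
    conv_rhs => rw [← hmap]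
    rw [Measure.fst, Measure.fst, Measure.map_map he.measurable measurable_fst,
      Measure.map_map measurable_fst hφ.measurable]
    rfl
  · rw [← he.comap_map (π.comap (Prod.map e e)).snd, ← he.comap_map ν₂, ← h₂]
    congr 1
    conv_rhs => rw [← hmap]
    rw [Measure.snd, Measure.snd, Measure.map_map he.measurable measurable_snd,
      Measure.map_map measurable_snd hφ.measurable]
    rfl

/-- Kantorovich duality for lower semicontinuous costs on Polish spaces, with bounded Borel
potentials. -/
theorem transportCost_le_of_dual_le [TopologicalSpace X] [PolishSpace X] [MeasurableSpace X]
    [BorelSpace X] {c : X × X → ℝ≥0} (hc : LowerSemicontinuous c) (ν₁ ν₂ : Measure X)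
    [IsProbabilityMeasure ν₁] [IsProbabilityMeasure ν₂] (M : ℝ≥0)
    (h : ∀ g f : X → ℝ, Measurable g → Measurable f → (∃ C, ∀ x, |g x| ≤ C) →
      (∃ C, ∀ x, |f x| ≤ C) → (∀ x y, g x + f y ≤ c (x, y)) →
      ∫ x, g x ∂ν₁ + ∫ x, f x ∂ν₂ ≤ M) :
    transportCost c ν₁ ν₂ ≤ M := by
  have hne : Nonempty X := ν₁.nonempty_of_neZero
  obtain ⟨e, hem, hinj, hsep⟩ := exists_binary_coding (X := X)
  -- Lusin-Souslin: injective Borel images of Borel sets are Borel here.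
  have he : MeasurableEmbedding e := hem.measurableEmbedding hinj
  have hre : ∀ I : Finset ℕ, Measurable fun x => I.restrict (e x) := fun I =>
    I.measurable_restrict.comp hem
  have hsum : ∀ (ν : Measure X) [IsProbabilityMeasure ν] (I : Finset ℕ) (g : (I → Bool) → ℝ),
      ∑ s, ((ν.map e).map I.restrict).real {s} * g s = ∫ x, g (I.restrict (e x)) ∂ν := by
    intro ν _ I g
    rw [Measure.map_map I.measurable_restrict hem]
    have : IsProbabilityMeasure (ν.map (I.restrict ∘ e)) :=
      Measure.isProbabilityMeasure_map (hre I).aemeasurable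
    have hmap := integral_map (μ := ν) (φ := I.restrict ∘ e) (hre I).aemeasurable
      (measurable_of_finite g).aestronglyMeasurable
    rw [integral_fintype .of_finite] at hmap
    simp only [smul_eq_mul] at hmap
    exact hmap
  have hbdd : ∀ (I : Finset ℕ) (g : (I → Bool) → ℝ), ∃ C, ∀ x, |g (I.restrict (e x))| ≤ C := by
    intro I g
    obtain ⟨C, hC⟩ := (Set.finite_range fun s => |g s|).bddAbove
    exact ⟨C, fun x => hC ⟨_, rfl⟩⟩
  obtain ⟨π, hπ, h1, h2, hcost⟩ := exists_coupling_cantor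
    ⟨ν₁.map e, Measure.isProbabilityMeasure_map hem.aemeasurable⟩
    ⟨ν₂.map e, Measure.isProbabilityMeasure_map hem.aemeasurable⟩
    (cellCost c e) (fun I J hIJ => cellCost_mono c e hIJ) M (by
      intro I g f hgf
      simp only [ProbabilityMeasure.coe_mk]
      rw [hsum ν₁ I g, hsum ν₂ I f]
      exact h _ _ ((measurable_of_finite g).comp (hre I)) ((measurable_of_finite f).comp (hre I))
        (hbdd I g) (hbdd I f) fun x y =>
          (hgf _ _).trans (NNReal.coe_le_coe.2 (cellCost_le c e I x y)))
  obtain ⟨π', h1', h2', hmap⟩ := exists_comap_coupling he h1 h2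
  have hp : IsProbabilityMeasure π' := ⟨by rw [← Measure.fst_univ, h1', measure_univ]⟩
  have hφ : MeasurableEmbedding (Prod.map e e) := he.prodMap he
  have hdm : ∀ n : ℕ, Measurable fun p : X × X => (cellCost c e (Finset.range n)
      ((Finset.range n).restrict (e p.1)) ((Finset.range n).restrict (e p.2)) : ℝ≥0∞) := fun n =>
    ((measurable_of_finite fun q : (Finset.range n → Bool) × (Finset.range n → Bool) =>
      cellCost c e (Finset.range n) q.1 q.2).comp
      (((hre _).comp measurable_fst).prodMk ((hre _).comp measurable_snd))).coe_nnreal_ennreal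
  calc transportCost c ν₁ ν₂ ≤ ∫⁻ p, (c p : ℝ≥0∞) ∂π' :=
        iInf_le_of_le π' (iInf_le_of_le hp (iInf_le_of_le h1' (iInf_le_of_le h2' le_rfl)))
    _ ≤ ∫⁻ p, ⨆ n : ℕ, (cellCost c e (Finset.range n)
        ((Finset.range n).restrict (e p.1)) ((Finset.range n).restrict (e p.2)) : ℝ≥0∞) ∂π' :=
        lintegral_mono fun p => le_iSup_cellCost hc hsep p.1 p.2
    _ = ⨆ n : ℕ, ∫⁻ p, (cellCost c e (Finset.range n)
        ((Finset.range n).restrict (e p.1)) ((Finset.range n).restrict (e p.2)) : ℝ≥0∞) ∂π' :=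
        lintegral_iSup hdm fun m n hmn p =>
          ENNReal.coe_le_coe.2 (cellCost_mono c e (Finset.range_mono hmn) _ _)
    _ ≤ M := iSup_le fun n => by
        refine le_of_eq_of_le ?_ (hcost (Finset.range n))
        rw [← hmap, hφ.lintegral_map]
        rfl

end Coding

end TransportEntropy

theorem mainTheorem7 {X : Type*} [TopologicalSpace X] [PolishSpace X] [MeasurableSpace X]
    [BorelSpace X] (c : X × X → ℝ≥0) (hc : LowerSemicontinuous c)
    (μ : Measure X) [IsProbabilityMeasure μ] :
    TransportEntropy.PropertyTau μ c ↔
      ∀ ν₁ ν₂ : Measure X, IsProbabilityMeasure ν₁ → IsProbabilityMeasure ν₂ →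
        TransportEntropy.transportCost c ν₁ ν₂ ≤
          InformationTheory.klDiv ν₁ μ + InformationTheory.klDiv ν₂ μ := by
  refine ⟨fun hτ ν₁ ν₂ _ _ => ?_, TransportEntropy.propertyTau_of_transportCost_le⟩
  by_cases h₁ : InformationTheory.klDiv ν₁ μ = ∞
  · simp [h₁]
  by_cases h₂ : InformationTheory.klDiv ν₂ μ = ∞
  · simp [h₂]
  rw [← ENNReal.coe_toNNReal (ENNReal.add_ne_top.2 ⟨h₁, h₂⟩)]
  refine TransportEntropy.transportCost_le_of_dual_le hc ν₁ ν₂ _ ?_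
  rintro g f hg hf ⟨C, hC⟩ ⟨D, hD⟩ hgf
  exact hτ.integral_add_integral_le h₁ h₂ hg hf hC hD hgf
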